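/- Let $1\to C\xrightarrow{i}E\xrightarrow{q}G\to 1$ be a central extension of groups, let $n\ge 2$, and suppose that $\gamma_n(E)=1$, where $\gamma_1(E)=E$ and $\gamma_{k+1}(E)=[\gamma_k(E),E]$. Regard $C$ as a subgroup of $E$ via $i$. Let $\mathfrak e\subset\mathbb Z[E]$, $\mathfrak g\subset\mathbb Z[G]$ be the augmentation ideals, let $\mathfrak c\subset \mathbb Z[E]$ be the image of the augmentation ideal of $\mathbb Z[C]$, and let $$D_n(E,C)=E\cap\bigl(1+\mathfrak c\,\mathfrak e+\mathfrak e^n\bigr)$$ be the $n$-th dimension subgroup of $E$ relative to $C$. For $m\ge 0$ put $A=\mathbb Z[G]$ and let $P_mB(A)$ be the complex of left $A/\mathfrak g^{m+1}$-modules with $P_mB_0=0$ and $$P_mB_i=(A/\mathfrak g^{m+1})\otimes_{\mathbb Z}(\mathfrak g/\mathfrak g^{m+1})^{\otimes (i-1)}\otimes_{\mathbb Z}(\mathfrak g/\mathfrak g^{m+2})\qquad(i\ge 1),$$ with differential $\overline{a_0}\otimes\cdots\otimes \overline{a_i}\mapsto\sum_{j=0}^{i-1}(-1)^j\,\overline{a_0}\otimes\cdots\otimes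 \overline{a_ja_{j+1}}\otimes\cdots\otimes \overline{a_i}$ for $i\ge2$. Let $P_mH_2(G)=H_2\bigl(\mathbb Z\otimes_{A/\mathfrak g^{m+1}}P_mB(A)\bigr)$, where $\mathbb Z$ is the trivial right module, and let $\rho_{m*}\colon H_2(G,\mathbb Z)\to P_mH_2(G)$ be the natural map, induced on bar chains by $[g|h]\mapsto 1\otimes\overline{1}\otimes\overline{g-1}\otimes\overline{h-1}$. Let $\kappa\colon H_2(G,\mathbb Z)\to C$ be the homomorphism adjoint to the cohomology class of the extension in $H^2(G,C)$ under the Kronecker pairing $H^2(G,C)\times H_2(G,\mathbb Z)\to C$. Then $$D_n(E,C)\cap C=\kappa\bigl(\operatorname{Ker}(\rho_{n-2\,*}\colon H_2(G,\mathbb Z)\to P_{n-2}H_2(G))\bigr).$$ -/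

import Mathlib

open scoped TensorProduct

noncomputable section

/-! ## Augmented algebras and the polynomial bar construction in degrees one to three -/

namespace PolyBar

universe u

section Augmented

variable {K A : Type*} [CommRing K] [Ring A] [Algebra K A] (ε : A →ₐ[K] K)

/-- The augmentation ideal `Ā = Ker ε` of the augmented `K`-algebra `(A, ε)`. -/
abbrev augIdeal : Ideal A := RingHom.ker ε

/-- The augmentation ideal `Ā` as a `K`-submodule of `A`. -/
abbrev aug : Submodule K A := (augIdeal ε).restrictScalars K

/-- The augmented quotient algebra `A / Ā ^ (n + 1)`. -/
abbrev TruncAlg (n : ℕ) : Type _ := A ⧸ (augIdeal ε) ^ (n + 1)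

/-- `Ā ^ (n + 1)` as a `K`-submodule of `Ā`. -/
abbrev augPow (n : ℕ) : Submodule K (aug ε) :=
  ((augIdeal ε ^ (n + 1)).restrictScalars K).submoduleOf (aug ε)

/-- The `K`-module `Ā / Ā ^ (n + 1)`. -/
abbrev TruncAug (n : ℕ) : Type _ := aug ε ⧸ augPow ε n

/-- The augmentation `A / Ā ^ (n + 1) → K` induced by `ε`. -/
def truncEps (n : ℕ) : TruncAlg ε n →ₐ[K] K :=
  Ideal.Quotient.liftₐ _ ε fun _ ha =>
    (Ideal.pow_le_self (I := augIdeal ε) (Nat.succ_ne_zero n)) ha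

@[simp] theorem truncEps_mk (n : ℕ) (a : A) :
    truncEps ε n (Ideal.Quotient.mk _ a) = ε a := rfl

/-- The map `Ā / Ā ^ (n + 1) → A / Ā ^ (n + 1)` induced by the inclusion of `Ā` in `A`. -/
def truncIncl (n : ℕ) : TruncAug ε n →ₗ[K] TruncAlg ε n :=
  Submodule.liftQ _
    ((Ideal.Quotient.mkₐ K (augIdeal ε ^ (n + 1))).toLinearMap ∘ₗ (aug ε).subtype)
    fun _ hx => Ideal.Quotient.eq_zero_iff_mem.2 hx

@[simp] theorem truncIncl_mk (n : ℕ) (a : aug ε) :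
    truncIncl ε n (Submodule.Quotient.mk a) = Ideal.Quotient.mk _ (a : A) := rfl

/-- Multiplication in `Ā`. -/
def augMul : aug ε →ₗ[K] aug ε →ₗ[K] aug ε :=
  LinearMap.mk₂ K (fun a b => ⟨(a : A) * b, (augIdeal ε).mul_mem_left _ b.2⟩)
    (fun _ _ _ => Subtype.ext (add_mul _ _ _)) (fun _ _ _ => Subtype.ext (smul_mul_assoc _ _ _))
    (fun _ _ _ => Subtype.ext (mul_add _ _ _)) (fun _ _ _ => Subtype.ext (mul_smul_comm _ _ _))

@[simp] theorem coe_augMul (a b : aug ε) : (augMul ε a b : A) = a * b := rfl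

/-- The multiplication `Ā / Ā ^ (n + 1) × Ā / Ā ^ (m + 1) → Ā / Ā ^ (m + 1)`, `m ≤ n + 1`. -/
def truncMul {n m : ℕ} (h : m ≤ n + 1) :
    TruncAug ε n →ₗ[K] TruncAug ε m →ₗ[K] TruncAug ε m :=
  Submodule.liftQ _
    (LinearMap.mk₂ K
      (fun (a : aug ε) (y : TruncAug ε m) => Submodule.mapQ _ (augPow ε m) (augMul ε a)
        (fun b (hb : (b : A) ∈ augIdeal ε ^ (m + 1)) =>
          (augIdeal ε ^ (m + 1)).mul_mem_left _ hb) y)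
      (by rintro a a' ⟨b⟩; exact congrArg Submodule.Quotient.mk (by simp))
      (by rintro c a ⟨b⟩; exact congrArg Submodule.Quotient.mk (by simp))
      (by intros; simp) (by intros; simp))
    (by
      intro a ha
      rw [LinearMap.mem_ker]
      ext b
      refine (Submodule.Quotient.mk_eq_zero _).2 ?_
      have ha' : (a : A) ∈ augIdeal ε ^ (n + 1) := ha
      have : (a : A) * b ∈ augIdeal ε ^ (n + 1 + 1) := by
        rw [Submodule.pow_succ]
        exact Ideal.mul_mem_mul ha' b.2
      exact Ideal.pow_le_pow_right (show m + 1 ≤ n + 1 + 1 by omega) this)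

@[simp] theorem truncMul_mk {n m : ℕ} (h : m ≤ n + 1) (a b : aug ε) :
    truncMul ε h (Submodule.Quotient.mk a) (Submodule.Quotient.mk b) =
      Submodule.Quotient.mk (augMul ε a b) := rfl

/-- The extension of a `K`-linear map `V → W` to an `R`-linear map `R ⊗ V → W`. -/
def freeExt {R V W : Type*} [Ring R] [Algebra K R] [AddCommGroup V] [Module K V]
    [AddCommGroup W] [Module K W] [Module R W] [IsScalarTower K R W] (f : V →ₗ[K] W) :
    R ⊗[K] V →ₗ[R] W :=
  TensorProduct.AlgebraTensorModule.lift
    (haveI : SMulCommClass K R W := ⟨fun k r w => by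
      rw [← algebraMap_smul R k (r • w), ← algebraMap_smul R k w, smul_smul, smul_smul,
        Algebra.commutes]⟩
    (haveI : SMulCommClass R K W := SMulCommClass.symm _ _ _
    LinearMap.toSpanSingleton R (V →ₗ[K] W) f))

@[simp] theorem freeExt_tmul {R V W : Type*} [Ring R] [Algebra K R] [AddCommGroup V] [Module K V]
    [AddCommGroup W] [Module K W] [Module R W] [IsScalarTower K R W] (f : V →ₗ[K] W)
    (r : R) (v : V) : freeExt f (r ⊗ₜ[K] v) = r • f v := rfl

/-- `P_n B_1(A) = A/Ā^{n+1} ⊗ Ā/Ā^{n+2}`. -/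
abbrev B1 (n : ℕ) : Type _ := TruncAlg ε n ⊗[K] TruncAug ε (n + 1)

/-- `P_n B_2(A) = A/Ā^{n+1} ⊗ Ā/Ā^{n+1} ⊗ Ā/Ā^{n+2}`. -/
abbrev B2 (n : ℕ) : Type _ := TruncAlg ε n ⊗[K] (TruncAug ε n ⊗[K] TruncAug ε (n + 1))

/-- `P_n B_3(A) = A/Ā^{n+1} ⊗ Ā/Ā^{n+1} ⊗ Ā/Ā^{n+1} ⊗ Ā/Ā^{n+2}`. -/
abbrev B3 (n : ℕ) : Type _ :=
  TruncAlg ε n ⊗[K] (TruncAug ε n ⊗[K] (TruncAug ε n ⊗[K] TruncAug ε (n + 1)))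

/-- The differential `P_n B_2(A) → P_n B_1(A)`,
`a₀ ⊗ a₁ ⊗ a₂ ↦ a₀a₁ ⊗ a₂ - a₀ ⊗ a₁a₂` (see `d2_tmul`). -/
def d2 (n : ℕ) : B2 ε n →ₗ[TruncAlg ε n] B1 ε n :=
  freeExt
    (TensorProduct.map (truncIncl ε n) LinearMap.id -
      (TensorProduct.mk K (TruncAlg ε n) (TruncAug ε (n + 1)) 1) ∘ₗ
        TensorProduct.lift (truncMul ε (le_refl (n + 1))))

theorem d2_tmul (n : ℕ) (a₀ : TruncAlg ε n) (a₁ : TruncAug ε n) (a₂ : TruncAug ε (n + 1)) :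
    d2 ε n (a₀ ⊗ₜ (a₁ ⊗ₜ a₂)) =
      (a₀ * truncIncl ε n a₁) ⊗ₜ a₂ - a₀ ⊗ₜ truncMul ε (le_refl (n + 1)) a₁ a₂ := by
  simp [d2, smul_sub, TensorProduct.smul_tmul']

/-- The differential `P_n B_3(A) → P_n B_2(A)`,
`a₀ ⊗ a₁ ⊗ a₂ ⊗ a₃ ↦ a₀a₁ ⊗ a₂ ⊗ a₃ - a₀ ⊗ a₁a₂ ⊗ a₃ + a₀ ⊗ a₁ ⊗ a₂a₃` (see `d3_tmul`). -/
def d3 (n : ℕ) : B3 ε n →ₗ[TruncAlg ε n] B2 ε n :=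
  freeExt
    (TensorProduct.map (truncIncl ε n) LinearMap.id -
      (TensorProduct.mk K (TruncAlg ε n) (TruncAug ε n ⊗[K] TruncAug ε (n + 1)) 1) ∘ₗ
        TensorProduct.map (TensorProduct.lift (truncMul ε (Nat.le_succ n))) LinearMap.id ∘ₗ
          (TensorProduct.assoc K _ _ _).symm.toLinearMap +
      (TensorProduct.mk K (TruncAlg ε n) (TruncAug ε n ⊗[K] TruncAug ε (n + 1)) 1) ∘ₗ
        TensorProduct.map LinearMap.id (TensorProduct.lift (truncMul ε (le_refl (n + 1)))))

theorem d3_tmul (n : ℕ) (a₀ : TruncAlg ε n) (a₁ a₂ : TruncAug ε n) (a₃ : TruncAug ε (n + 1)) :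
    d3 ε n (a₀ ⊗ₜ (a₁ ⊗ₜ (a₂ ⊗ₜ a₃))) =
      (a₀ * truncIncl ε n a₁) ⊗ₜ (a₂ ⊗ₜ a₃) - a₀ ⊗ₜ (truncMul ε (Nat.le_succ n) a₁ a₂ ⊗ₜ a₃) +
        a₀ ⊗ₜ (a₁ ⊗ₜ truncMul ε (le_refl (n + 1)) a₂ a₃) := by
  simp [d3, smul_sub, smul_add, TensorProduct.smul_tmul']

theorem d2_comp_d3 (n : ℕ) : d2 ε n ∘ₗ d3 ε n = 0 := by
  refine TensorProduct.AlgebraTensorModule.ext fun a₀ v => ?_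
  induction v with
  | zero => simp
  | add x y hx hy => rw [TensorProduct.tmul_add, map_add, hx, hy, map_add]
  | tmul a₁ w =>
    induction w with
    | zero => simp
    | add x y hx hy => rw [TensorProduct.tmul_add, TensorProduct.tmul_add, map_add, hx, hy, map_add]
    | tmul a₂ a₃ =>
      obtain ⟨a₁, rfl⟩ := Submodule.Quotient.mk_surjective _ a₁
      obtain ⟨a₂, rfl⟩ := Submodule.Quotient.mk_surjective _ a₂
      obtain ⟨a₃, rfl⟩ := Submodule.Quotient.mk_surjective _ a₃
      have h : augMul ε (augMul ε a₁ a₂) a₃ = augMul ε a₁ (augMul ε a₂ a₃) :=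
        Subtype.ext (mul_assoc _ _ _)
      simp [d3_tmul, d2_tmul, h, mul_assoc]

/-- The relations `z·r ⊗ m = z ⊗ r·m` in `K ⊗ M`, where `A / Ā ^ (n + 1)` acts on `K` from the right
through the augmentation. -/
def balRel (n : ℕ) (M : Type*) [AddCommGroup M] [Module K M] [Module (TruncAlg ε n) M] :
    Submodule K (K ⊗[K] M) :=
  Submodule.span K
    {t | ∃ (z : K) (r : TruncAlg ε n) (m : M), t = (z * truncEps ε n r) ⊗ₜ[K] m - z ⊗ₜ[K] (r • m)}

/-- The tensor product `K ⊗_{A/Ā^{n+1}} M` of the trivial right module `K` and a left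
`A / Ā ^ (n + 1)`-module `M`. -/
abbrev Bal (n : ℕ) (M : Type*) [AddCommGroup M] [Module K M] [Module (TruncAlg ε n) M] : Type _ :=
  (K ⊗[K] M) ⧸ balRel ε n M

section Bal

variable (n : ℕ) {M M' : Type*} [AddCommGroup M] [Module K M] [Module (TruncAlg ε n) M]
  [AddCommGroup M'] [Module K M'] [Module (TruncAlg ε n) M']

/-- The class of `z ⊗ m` in `K ⊗_{A/Ā^{n+1}} M`. -/
def balMk (z : K) (m : M) : Bal ε n M := Submodule.Quotient.mk (z ⊗ₜ[K] m)

/-- The map `K ⊗ f` induced by an `A / Ā ^ (n + 1)`-linear map `f`. -/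
def balMap [IsScalarTower K (TruncAlg ε n) M] [IsScalarTower K (TruncAlg ε n) M'] (f : M →ₗ[TruncAlg ε n] M') : Bal ε n M →ₗ[K] Bal ε n M' :=
  Submodule.mapQ _ _ (TensorProduct.map LinearMap.id (f.restrictScalars K)) (by
    rw [balRel, Submodule.span_le]
    rintro _ ⟨z, r, m, rfl⟩
    refine Submodule.subset_span ⟨z, r, f m, ?_⟩
    simp)

@[simp] theorem balMap_balMk [IsScalarTower K (TruncAlg ε n) M]
    [IsScalarTower K (TruncAlg ε n) M'] (f : M →ₗ[TruncAlg ε n] M') (z : K) (m : M) :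
    balMap ε n f (balMk ε n z m) = balMk ε n z (f m) := rfl

theorem balMk_smul (z : K) (r : TruncAlg ε n) (m : M) :
    balMk ε n z (r • m) = balMk ε n (z * truncEps ε n r) m :=
  ((Submodule.Quotient.eq (balRel ε n M)).2 (Submodule.subset_span ⟨z, r, m, rfl⟩)).symm

theorem balMk_add_right (z : K) (m m' : M) :
    balMk ε n z (m + m') = balMk ε n z m + balMk ε n z m' := by
  simp [balMk, TensorProduct.tmul_add]

theorem balMk_sub_right (z : K) (m m' : M) :
    balMk ε n z (m - m') = balMk ε n z m - balMk ε n z m' := by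
  simp [balMk, TensorProduct.tmul_sub]

/-- The map `z ↦ z ⊗ m`. -/
def balLin (m : M) : K →ₗ[K] Bal ε n M :=
  (balRel ε n M).mkQ ∘ₗ (TensorProduct.mk K K M).flip m

@[simp] theorem balLin_apply (m : M) (z : K) : balLin ε n m z = balMk ε n z m := rfl

end Bal

/-- The 2-cycles of `K ⊗_{A/Ā^{n+1}} P_n B(A)`. -/
abbrev Z2 (n : ℕ) : Submodule K (Bal ε n (B2 ε n)) := LinearMap.ker (balMap ε n (d2 ε n))

/-- The 2-boundaries of `K ⊗_{A/Ā^{n+1}} P_n B(A)`, as a submodule of the 2-cycles. -/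
abbrev Bd2 (n : ℕ) : Submodule K (Z2 ε n) :=
  (LinearMap.range (balMap ε n (d3 ε n))).submoduleOf (Z2 ε n)

theorem range_le_Z2 (n : ℕ) : LinearMap.range (balMap ε n (d3 ε n)) ≤ Z2 ε n := by
  rintro _ ⟨x, rfl⟩
  obtain ⟨x, rfl⟩ := Submodule.Quotient.mk_surjective _ x
  induction x with
  | zero => simp
  | add x y hx hy => simpa only [Submodule.Quotient.mk_add, map_add] using add_mem hx hy
  | tmul z m =>
    change balMk ε n z (d2 ε n (d3 ε n m)) = 0
    rw [← LinearMap.comp_apply, d2_comp_d3]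
    simp [balMk]

/-- Polynomial homology `P_n H_2(A, K) = H_2(K ⊗_{A/Ā^{n+1}} P_n B(A))`. -/
abbrev PH2 (n : ℕ) : Type _ := Z2 ε n ⧸ Bd2 ε n

end Augmented

/-! ## Polynomial homology of groups -/

section Groups

/-- The augmentation `K[G] → K`. -/
def groupAug (K G : Type*) [CommRing K] [Group G] : MonoidAlgebra K G →ₐ[K] K :=
  MonoidAlgebra.lift K K G 1

@[simp] theorem groupAug_single {K G : Type*} [CommRing K] [Group G] (g : G) (z : K) :
    groupAug K G (MonoidAlgebra.single g z) = z := by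
  simp [groupAug]

section Elements

variable (K : Type*) [CommRing K] {G : Type*} [Group G]

/-- The element `g - 1` of the augmentation ideal of `K[G]`. -/
def gSub (g : G) : aug (groupAug K G) :=
  ⟨MonoidAlgebra.of K G g - 1, by simp [RingHom.mem_ker]⟩

theorem gSub_mul (g h : G) :
    augMul (groupAug K G) (gSub K g) (gSub K h) = gSub K (g * h) - gSub K g - gSub K h := by
  apply Subtype.ext
  simp only [coe_augMul, gSub, map_mul, Submodule.coe_sub]
  noncomm_ring

/-- The class of `g - 1` modulo the `(n+1)`-st power of the augmentation ideal. -/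
def pcl (n : ℕ) (g : G) : TruncAug (groupAug K G) n :=
  Submodule.Quotient.mk (gSub K g)

theorem truncMul_pcl {n m : ℕ} (h : m ≤ n + 1) (x y : G) :
    truncMul (groupAug K G) h (pcl K n x) (pcl K m y) =
      pcl K m (x * y) - pcl K m x - pcl K m y := by
  simp only [pcl, truncMul_mk, gSub_mul, Submodule.Quotient.mk_sub]

theorem truncEps_pcl (n : ℕ) (g : G) :
    truncEps (groupAug K G) n (truncIncl (groupAug K G) n (pcl K n g)) = 0 :=
  (gSub K g).2

/-- The augmentation ideal acts as zero on the trivial coefficients. -/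
theorem balMk_pcl_tmul (n : ℕ) (z : K) (g : G) {V : Type*} [AddCommGroup V] [Module K V] (v : V) :
    balMk (groupAug K G) n z (truncIncl (groupAug K G) n (pcl K n g) ⊗ₜ[K] v) = 0 := by
  have h : truncIncl (groupAug K G) n (pcl K n g) ⊗ₜ[K] v =
      truncIncl (groupAug K G) n (pcl K n g) • ((1 : TruncAlg (groupAug K G) n) ⊗ₜ[K] v) := by
    simp [TensorProduct.smul_tmul']
  rw [h, balMk_smul, truncEps_pcl, mul_zero]
  simp [balMk]

/-- The element `1 ⊗ (g - 1)` of `P_n B_1(K[G])`. -/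
def gen1 (n : ℕ) (g : G) : B1 (groupAug K G) n := 1 ⊗ₜ pcl K (n + 1) g

/-- The element `1 ⊗ (g - 1) ⊗ (h - 1)` of `P_n B_2(K[G])`. -/
def gen2 (n : ℕ) (g : G × G) : B2 (groupAug K G) n := 1 ⊗ₜ (pcl K n g.1 ⊗ₜ pcl K (n + 1) g.2)

/-- The element `1 ⊗ (g - 1) ⊗ (h - 1) ⊗ (k - 1)` of `P_n B_3(K[G])`. -/
def gen3 (n : ℕ) (g : G × G × G) : B3 (groupAug K G) n :=
  1 ⊗ₜ (pcl K n g.1 ⊗ₜ (pcl K n g.2.1 ⊗ₜ pcl K (n + 1) g.2.2))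

/-- The chain map `ρ_n` in degree one, `z·[g] ↦ z ⊗ (1 ⊗ (g - 1))`. -/
def rhoChain1 (n : ℕ) : (G →₀ K) →ₗ[K] Bal (groupAug K G) n (B1 (groupAug K G) n) :=
  Finsupp.lsum K fun g => balLin (groupAug K G) n (gen1 K n g)

/-- The chain map `ρ_n` in degree two, `z·[g|h] ↦ z ⊗ (1 ⊗ (g - 1) ⊗ (h - 1))`. -/
def rhoChain2 (n : ℕ) : (G × G →₀ K) →ₗ[K] Bal (groupAug K G) n (B2 (groupAug K G) n) :=
  Finsupp.lsum K fun g => balLin (groupAug K G) n (gen2 K n g)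

/-- The chain map `ρ_n` in degree three,
`z·[g|h|k] ↦ z ⊗ (1 ⊗ (g - 1) ⊗ (h - 1) ⊗ (k - 1))`. -/
def rhoChain3 (n : ℕ) : (G × G × G →₀ K) →ₗ[K] Bal (groupAug K G) n (B3 (groupAug K G) n) :=
  Finsupp.lsum K fun g => balLin (groupAug K G) n (gen3 K n g)

end Elements

variable (K : Type u) [CommRing K] {G : Type u} [Group G]

/-- The second homology group `H₂(G, K)` with trivial coefficients. -/
abbrev H2Triv (K G : Type u) [CommRing K] [Group G] : Type u :=
  groupHomology.H2 (Rep.trivial K G K)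

/-- The map induced on `H₂` by a map on 2-cycles that vanishes on 2-boundaries. -/
def H2Lift {M : Type*} [AddCommGroup M] [Module K M]
    (f : groupHomology.cycles₂ (Rep.trivial K G K) →ₗ[K] M)
    (hf : ∀ x, x.1 ∈ groupHomology.boundaries₂ (Rep.trivial K G K) → f x = 0) :
    H2Triv K G →ₗ[K] M :=
  Submodule.liftQ _ f (fun x hx => hf x
      ((groupHomology.H2π_eq_zero_iff x).1 (LinearMap.mem_ker.1 hx))) ∘ₗ
    (LinearMap.quotKerEquivOfSurjective (groupHomology.H2π (Rep.trivial K G K)).hom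
      ((ModuleCat.epi_iff_surjective _).1 inferInstance)).symm.toLinearMap

theorem H2Lift_H2π {M : Type*} [AddCommGroup M] [Module K M]
    (f : groupHomology.cycles₂ (Rep.trivial K G K) →ₗ[K] M)
    (hf : ∀ x, x.1 ∈ groupHomology.boundaries₂ (Rep.trivial K G K) → f x = 0)
    (x : groupHomology.cycles₂ (Rep.trivial K G K)) :
    H2Lift K f hf (groupHomology.H2π (Rep.trivial K G K) x) = f x := by
  have h : (LinearMap.quotKerEquivOfSurjective (groupHomology.H2π (Rep.trivial K G K)).hom
      ((ModuleCat.epi_iff_surjective _).1 inferInstance)).symm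
        (groupHomology.H2π (Rep.trivial K G K) x) = Submodule.Quotient.mk x :=
    (LinearEquiv.symm_apply_eq _).2 rfl
  simp only [H2Lift, LinearMap.comp_apply, LinearEquiv.coe_coe]
  rw [h]
  rfl

theorem rhoChain_d₂₁ (n : ℕ) (x : G × G →₀ K) :
    balMap (groupAug K G) n (d2 (groupAug K G) n) (rhoChain2 K n x) =
      rhoChain1 K n ((groupHomology.d₂₁ (Rep.trivial K G K)).hom x) := by
  induction x using Finsupp.induction_linear with
  | zero => simp
  | add x y hx hy => simp only [map_add, hx, hy]
  | single g z =>
    have h := groupHomology.d₂₁_single (A := Rep.trivial K G K) g z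
    rw [h]
    simp only [rhoChain2, rhoChain1, map_add, map_sub, Finsupp.lsum_single, balLin_apply,
      balMap_balMk, gen2, gen1, d2_tmul, one_mul, balMk_sub_right, balMk_pcl_tmul, truncMul_pcl,
      TensorProduct.tmul_sub, Representation.trivial_apply]
    abel

theorem rhoChain_d₃₂ (n : ℕ) (x : G × G × G →₀ K) :
    balMap (groupAug K G) n (d3 (groupAug K G) n) (rhoChain3 K n x) =
      rhoChain2 K n ((groupHomology.d₃₂ (Rep.trivial K G K)).hom x) := by
  induction x using Finsupp.induction_linear with
  | zero => simp
  | add x y hx hy => simp only [map_add, hx, hy]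
  | single g z =>
    have h := groupHomology.d₃₂_single (A := Rep.trivial K G K) g z
    rw [h]
    simp only [rhoChain3, rhoChain2, map_add, map_sub, Finsupp.lsum_single, balLin_apply,
      balMap_balMk, gen3, gen2, d3_tmul, one_mul, balMk_add_right, balMk_sub_right, balMk_pcl_tmul,
      truncMul_pcl, TensorProduct.tmul_sub, TensorProduct.sub_tmul, Representation.trivial_apply]
    abel

/-- The map from 2-cycles to polynomial homology classes induced by `ρ_n`. -/
def rhoCycles (n : ℕ) : groupHomology.cycles₂ (Rep.trivial K G K) →ₗ[K] PH2 (groupAug K G) n :=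
  (Bd2 (groupAug K G) n).mkQ ∘ₗ
    LinearMap.codRestrict (Z2 (groupAug K G) n)
      (rhoChain2 K n ∘ₗ (groupHomology.cycles₂ (Rep.trivial K G K)).subtype)
      (fun x => by
        have hx : (groupHomology.d₂₁ (Rep.trivial K G K)).hom x.1 = 0 := x.2
        exact LinearMap.mem_ker.2
          ((rhoChain_d₂₁ K n x.1).trans ((congrArg (rhoChain1 K n) hx).trans (map_zero _))))

/-- The natural map `H₂(G, K) → P_n H₂(K[G], K)` induced by `ρ_n`. -/
def rhoTriv (n : ℕ) (G : Type u) [Group G] : H2Triv K G →ₗ[K] PH2 (groupAug K G) n :=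
  H2Lift K (rhoCycles K n) (by
    rintro x ⟨y, hy⟩
    refine (Submodule.Quotient.mk_eq_zero _).2 ⟨rhoChain3 K n y, ?_⟩
    rw [rhoChain_d₃₂]
    exact congrArg (rhoChain2 K n) hy)

theorem rhoTriv_H2π (n : ℕ) (x : groupHomology.cycles₂ (Rep.trivial K G K)) :
    rhoTriv K n G (groupHomology.H2π (Rep.trivial K G K) x) = rhoCycles K n x :=
  H2Lift_H2π K _ _ x

/-! ## The Kronecker pairing -/

section Kronecker

variable {M : Type u} [AddCommGroup M] [Module K M]

/-- A cochain that is a 2-cocycle vanishes on 2-boundaries. -/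
theorem eval_d₃₂ (f : groupCohomology.cocycles₂ (Rep.trivial K G M)) (x : G × G × G →₀ K) :
    Finsupp.linearCombination K (f.1 : G × G → M)
      ((groupHomology.d₃₂ (Rep.trivial K G K)).hom x) = 0 := by
  induction x using Finsupp.induction_linear with
  | zero => simp
  | add x y hx hy => simp only [map_add, hx, hy, add_zero]
  | single g z =>
    have h := groupHomology.d₃₂_single (A := Rep.trivial K G K) g z
    have hf := (groupCohomology.mem_cocycles₂_def f.1).1 f.2 g.1 g.2.1 g.2.2
    rw [h]
    simp only [Representation.trivial_apply] at hf ⊢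
    simp only [map_add, map_sub, Finsupp.linearCombination_single]
    rw [← smul_sub, ← smul_add, ← smul_sub, hf, smul_zero]

/-- A 2-coboundary vanishes on 2-cycles. -/
theorem eval_d₁₂ (u : G → M) (x : G × G →₀ K) :
    Finsupp.linearCombination K
        ((groupCohomology.d₁₂ (Rep.trivial K G M)).hom u : G × G → M) x =
      Finsupp.linearCombination K u ((groupHomology.d₂₁ (Rep.trivial K G K)).hom x) := by
  induction x using Finsupp.induction_linear with
  | zero => simp
  | add x y hx hy => simp only [map_add, hx, hy]
  | single g z =>
    have h := groupHomology.d₂₁_single (A := Rep.trivial K G K) g z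
    rw [h]
    simp only [Representation.trivial_apply, map_add, map_sub, Finsupp.linearCombination_single,
      groupCohomology.d₁₂_hom_apply, smul_add, smul_sub]

/-- Evaluation of a 2-cocycle on homology classes, `[∑ zᵢ·[gᵢ|hᵢ]] ↦ ∑ zᵢ f(gᵢ, hᵢ)`. -/
def evalCocycle (f : groupCohomology.cocycles₂ (Rep.trivial K G M)) : H2Triv K G →ₗ[K] M :=
  H2Lift K (Finsupp.linearCombination K (f.1 : G × G → M) ∘ₗ
    (groupHomology.cycles₂ (Rep.trivial K G K)).subtype) (by
      rintro x ⟨y, hy⟩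
      exact (congrArg (Finsupp.linearCombination K (f.1 : G × G → M)) hy).symm.trans
        (eval_d₃₂ K f y))

theorem evalCocycle_H2π (f : groupCohomology.cocycles₂ (Rep.trivial K G M))
    (x : groupHomology.cycles₂ (Rep.trivial K G K)) :
    evalCocycle K f (groupHomology.H2π (Rep.trivial K G K) x) =
      Finsupp.linearCombination K (f.1 : G × G → M) x.1 :=
  H2Lift_H2π K _ _ x

/-- The pairing of 2-cocycles with `H₂(G, K)`, as a linear map. -/
def evalCocycleLin :
    groupCohomology.cocycles₂ (Rep.trivial K G M) →ₗ[K] H2Triv K G →ₗ[K] M where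
  toFun := evalCocycle K
  map_add' f f' := by
    refine LinearMap.ext fun x => ?_
    induction x using groupHomology.H2_induction_on with
    | h x =>
      refine (evalCocycle_H2π K _ x).trans (Eq.trans ?_
        (congrArg₂ (· + ·) (evalCocycle_H2π K f x) (evalCocycle_H2π K f' x)).symm)
      exact (Finsupp.sum_congr fun _ _ => smul_add _ _ _).trans Finsupp.sum_add
  map_smul' c f := by
    refine LinearMap.ext fun x => ?_
    induction x using groupHomology.H2_induction_on with
    | h x =>
      refine (evalCocycle_H2π K _ x).trans (Eq.trans ?_
        (congrArg (c • ·) (evalCocycle_H2π K f x)).symm)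
      exact (Finsupp.sum_congr fun _ _ => smul_comm _ _ _).trans Finsupp.smul_sum.symm

theorem evalCocycleLin_eq_zero (f : groupCohomology.cocycles₂ (Rep.trivial K G M))
    (hf : groupCohomology.H2π (Rep.trivial K G M) f = 0) : evalCocycleLin K f = 0 := by
  obtain ⟨u, hu⟩ := (groupCohomology.H2π_eq_zero_iff f).1 hf
  refine LinearMap.ext fun x => ?_
  induction x using groupHomology.H2_induction_on with
  | h x =>
    refine (evalCocycle_H2π K f x).trans ?_
    have hx : (groupHomology.d₂₁ (Rep.trivial K G K)).hom x.1 = 0 := x.2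
    have hu' : (f.1 : G × G → M) =
      (groupCohomology.d₁₂ (Rep.trivial K G M)).hom u := hu.symm
    rw [hu', eval_d₁₂, hx, map_zero]
    rfl

/-- The Kronecker pairing `H²(G, M) × H₂(G, K) → M`, for a trivial `G`-module `M`;
see `kronecker_H2π`. -/
def kronecker (G : Type u) [Group G] (M : Type u) [AddCommGroup M] [Module K M] :
    groupCohomology.H2 (Rep.trivial K G M) →ₗ[K] H2Triv K G →ₗ[K] M :=
  Submodule.liftQ _ (evalCocycleLin K) (fun f hf =>
      LinearMap.mem_ker.2 (evalCocycleLin_eq_zero K f (LinearMap.mem_ker.1 hf))) ∘ₗ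
    (LinearMap.quotKerEquivOfSurjective (groupCohomology.H2π (Rep.trivial K G M)).hom
      ((ModuleCat.epi_iff_surjective _).1 inferInstance)).symm.toLinearMap

theorem kronecker_H2π (f : groupCohomology.cocycles₂ (Rep.trivial K G M))
    (x : groupHomology.cycles₂ (Rep.trivial K G K)) :
    kronecker K G M (groupCohomology.H2π (Rep.trivial K G M) f)
        (groupHomology.H2π (Rep.trivial K G K) x) =
      Finsupp.linearCombination K (f.1 : G × G → M) x.1 := by
  have h : (LinearMap.quotKerEquivOfSurjective (groupCohomology.H2π (Rep.trivial K G M)).hom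
      ((ModuleCat.epi_iff_surjective _).1 inferInstance)).symm
        (groupCohomology.H2π (Rep.trivial K G M) f) = Submodule.Quotient.mk f :=
    (LinearEquiv.symm_apply_eq _).2 rfl
  simp only [kronecker, LinearMap.comp_apply, LinearEquiv.coe_coe]
  rw [h]
  exact evalCocycle_H2π K f x

end Kronecker

end Groups

/-! ## Integral homology and polynomial homology of a group -/

section Integral

/-- The second integral homology group `H₂(G) = H₂(G, ℤ)`. -/
abbrev H2Z (G : Type) [Group G] : Type := H2Triv ℤ G

/-- Polynomial homology `P_n H₂(G) = P_n H₂(ℤ[G], ℤ)`. -/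
abbrev PnH2 (n : ℕ) (G : Type) [Group G] : Type := PH2 (groupAug ℤ G) n

/-- The natural map `ρ_{n*} : H₂(G) → P_n H₂(G)`. -/
def rho (n : ℕ) (G : Type) [Group G] : H2Z G →ₗ[ℤ] PnH2 n G := rhoTriv ℤ n G

end Integral

/-! ## The cohomology class of a central extension -/

section Extension

variable {G : Type} [Group G]
variable {C : Type} [CommGroup C] {E : Type*} [Group E] (S : GroupExtension C E G)

theorem section_mem (σ : S.Section) (g h : G) :
    σ g * σ h * (σ (g * h))⁻¹ ∈ S.inl.range := by
  rw [S.range_inl_eq_ker_rightHom, MonoidHom.mem_ker]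
  simp

/-- The factor set `(g, h) ↦ σ(g) σ(h) σ(gh)⁻¹` of a set-theoretic section `σ`. -/
def factorSet (σ : S.Section) (g h : G) : C := (section_mem S σ g h).choose

theorem inl_factorSet (σ : S.Section) (g h : G) :
    S.inl (factorSet S σ g h) = σ g * σ h * (σ (g * h))⁻¹ :=
  (section_mem S σ g h).choose_spec

theorem factorSet_cocycle (hC : S.inl.range ≤ Subgroup.center E) (σ : S.Section) (g h j : G) :
    factorSet S σ h j * factorSet S σ g (h * j) = factorSet S σ g h * factorSet S σ (g * h) j := by
  apply S.inl_injective
  have hc : σ g * S.inl (factorSet S σ h j) = S.inl (factorSet S σ h j) * σ g :=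
    Subgroup.mem_center_iff.1 (hC ⟨_, rfl⟩) _
  rw [map_mul, map_mul, inl_factorSet S σ g (h * j), ← mul_assoc, ← mul_assoc, ← hc,
    inl_factorSet, inl_factorSet, inl_factorSet, mul_assoc g h j]
  group

/-- The factor set of a section of a central extension, as a 2-cocycle. -/
def extCocycle (hC : S.inl.range ≤ Subgroup.center E) (σ : S.Section) :
    groupCohomology.cocycles₂ (Rep.trivial ℤ G (Additive C)) :=
  ⟨fun g => (Additive.ofMul (factorSet S σ g.1 g.2) : Additive C), by
    refine (groupCohomology.mem_cocycles₂_def (A := Rep.trivial ℤ G (Additive C)) _).2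
      fun g h j => ?_
    have := congrArg Additive.ofMul (factorSet_cocycle S hC σ g h j)
    rw [ofMul_mul, ofMul_mul] at this
    change Additive.ofMul (factorSet S σ h j) - Additive.ofMul (factorSet S σ (g * h) j) +
      Additive.ofMul (factorSet S σ g (h * j)) - Additive.ofMul (factorSet S σ g h) = 0
    rw [sub_add_eq_add_sub, this, add_sub_cancel_right, sub_self]⟩

theorem extCocycle_apply (hC : S.inl.range ≤ Subgroup.center E) (σ : S.Section) (g h : G) :
    (extCocycle S hC σ).1 (g, h) = Additive.ofMul (factorSet S σ g h) := rfl

/-- A set-theoretic section of a group extension. -/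
def someSection : S.Section :=
  ⟨Function.surjInv S.rightHom_surjective, Function.rightInverse_surjInv S.rightHom_surjective⟩

/-- The cohomology class in `H²(G, C)` of a central extension `C → E → G`. It is represented by the
factor set of every set-theoretic section (see `extClass_eq`). -/
def extClass (hC : S.inl.range ≤ Subgroup.center E) :
    groupCohomology.H2 (Rep.trivial ℤ G (Additive C)) :=
  groupCohomology.H2π (Rep.trivial ℤ G (Additive C)) (extCocycle S hC (someSection S))

theorem H2π_extCocycle_eq (hC : S.inl.range ≤ Subgroup.center E) (σ τ : S.Section) :
    groupCohomology.H2π (Rep.trivial ℤ G (Additive C)) (extCocycle S hC σ) =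
      groupCohomology.H2π (Rep.trivial ℤ G (Additive C)) (extCocycle S hC τ) := by
  have hu : ∀ g, ∃ c : C, S.inl c = σ g * (τ g)⁻¹ := fun g => by
    have : σ g * (τ g)⁻¹ ∈ S.inl.range := by
      rw [S.range_inl_eq_ker_rightHom, MonoidHom.mem_ker]
      simp
    exact this
  choose u hu using hu
  have hσ : ∀ g, σ g = S.inl (u g) * τ g := fun g => by rw [hu]; group
  have hc : ∀ (c : C) (e : E), e * S.inl c = S.inl c * e := fun c e =>
    Subgroup.mem_center_iff.1 (hC ⟨c, rfl⟩) e
  refine (groupCohomology.H2π_eq_iff _ _).2 ⟨fun g => Additive.ofMul (u g), ?_⟩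
  funext g
  obtain ⟨g, h⟩ := g
  have key : u h * u g * factorSet S τ g h = factorSet S σ g h * u (g * h) := by
    apply S.inl_injective
    rw [map_mul, map_mul, map_mul, inl_factorSet, inl_factorSet, hσ g, hσ h, hσ (g * h)]
    have h1 : S.inl (u g) * τ g * (S.inl (u h) * τ h) =
        S.inl (u h) * S.inl (u g) * (τ g * τ h) := by
      rw [← hc (u h) (S.inl (u g))]
      rw [mul_assoc, ← mul_assoc (τ g), hc (u h) (τ g)]
      group
    rw [h1, mul_inv_rev, mul_assoc (S.inl (u h) * S.inl (u g))]
    simp only [mul_assoc, inv_mul_cancel, mul_one]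
  have key' := congrArg Additive.ofMul key
  simp only [ofMul_mul] at key'
  change Additive.ofMul (u h) - Additive.ofMul (u (g * h)) + Additive.ofMul (u g) =
    Additive.ofMul (factorSet S σ g h) - Additive.ofMul (factorSet S τ g h)
  rw [eq_sub_iff_add_eq, sub_add_eq_add_sub, sub_add_eq_add_sub, key', add_sub_cancel_right]

theorem extClass_eq (hC : S.inl.range ≤ Subgroup.center E) (σ : S.Section) :
    extClass S hC = groupCohomology.H2π (Rep.trivial ℤ G (Additive C)) (extCocycle S hC σ) :=
  H2π_extCocycle_eq S hC _ σ

/-- The homomorphism `κ : H₂(G) → C` adjoint to the class of a central extension under the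
Kronecker pairing. -/
def kappa (hC : S.inl.range ≤ Subgroup.center E) : H2Z G →ₗ[ℤ] Additive C :=
  kronecker ℤ G (Additive C) (extClass S hC)

end Extension

/-! ## Relative dimension subgroups -/

section Dimension

variable {E : Type*} [Group E]

/-- The image in `ℤ[E]` of the augmentation ideal of `ℤ[N]`, for a subgroup `N` of `E`. -/
def subAug (N : Subgroup E) : Submodule ℤ (MonoidAlgebra ℤ E) :=
  (aug (groupAug ℤ N)).map (MonoidAlgebra.mapDomainAlgHom ℤ ℤ N.subtype).toLinearMap

/-- `𝔫𝔢 + 𝔢ⁿ`, where `𝔫` and `𝔢` are the augmentation ideals of `N` and `E`. -/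
def relPow (n : ℕ) (N : Subgroup E) : Submodule ℤ (MonoidAlgebra ℤ E) :=
  subAug N * aug (groupAug ℤ E) + (augIdeal (groupAug ℤ E) ^ n).restrictScalars ℤ

theorem relPow_mul_mem (n : ℕ) (N : Subgroup E) {x : MonoidAlgebra ℤ E} (hx : x ∈ relPow n N)
    (y : MonoidAlgebra ℤ E) : x * y ∈ relPow n N := by
  obtain ⟨a, ha, b, hb, rfl⟩ := Submodule.mem_sup.1 hx
  rw [add_mul]
  refine Submodule.add_mem_sup ?_ ((augIdeal (groupAug ℤ E) ^ n).mul_mem_right y hb)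
  clear hx
  induction ha using Submodule.mul_induction_on' with
  | mem_mul_mem p hp q hq =>
    rw [mul_assoc]
    exact Submodule.mul_mem_mul hp ((augIdeal (groupAug ℤ E)).mul_mem_right y hq)
  | add p _ q _ hp hq =>
    rw [add_mul]
    exact add_mem hp hq

/-- The `n`-th dimension subgroup `D_n(E, N) = E ∩ (1 + 𝔫𝔢 + 𝔢ⁿ)` of `E` relative to `N`. -/
def relDimSubgroup (n : ℕ) (N : Subgroup E) : Subgroup E where
  carrier := {x | MonoidAlgebra.of ℤ E x - 1 ∈ relPow n N}
  one_mem' := by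
    change MonoidAlgebra.of ℤ E 1 - 1 ∈ relPow n N
    rw [map_one, sub_self]
    exact zero_mem _
  mul_mem' {x y} hx hy := by
    have h : MonoidAlgebra.of ℤ E (x * y) - 1 =
        (MonoidAlgebra.of ℤ E x - 1) * MonoidAlgebra.of ℤ E y +
          (MonoidAlgebra.of ℤ E y - 1) := by
      rw [map_mul]
      noncomm_ring
    change _ ∈ relPow n N
    rw [h]
    exact add_mem (relPow_mul_mem n N hx _) hy
  inv_mem' {x} hx := by
    have h : MonoidAlgebra.of ℤ E x⁻¹ - 1 =
        -((MonoidAlgebra.of ℤ E x - 1) * MonoidAlgebra.of ℤ E x⁻¹) := by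
      rw [sub_mul, ← map_mul, mul_inv_cancel, map_one]
      noncomm_ring
    change _ ∈ relPow n N
    rw [h]
    exact neg_mem (relPow_mul_mem n N hx _)

theorem mem_relDimSubgroup (n : ℕ) (N : Subgroup E) (x : E) :
    x ∈ relDimSubgroup n N ↔ MonoidAlgebra.of ℤ E x - 1 ∈ relPow n N := Iff.rfl

end Dimension

end PolyBar

end

open scoped TensorProduct

noncomputable section

namespace PolyBar

/-! ### The ideal 𝔠𝔢 and the projection ℤ[E] → ℤ[G]. -/

section CentralExtension

open MonoidAlgebra

/-! Everything is compared inside ℤ[E]/𝔠𝔢. There c ↦ c - 1 embeds C as a group, since (c - 1)(d - 1)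
∈ 𝔠𝔢 and the C-coordinate relative to a section kills 𝔠𝔢 (`exists_coordinate`). Because C is
central, the kernel 𝔠ℤ[E] of ℤ[E] → ℤ[G] multiplies 𝔢 into 𝔠𝔢 from either side, so modulo 𝔠𝔢 a
product of two elements of 𝔢 depends only on their images in ℤ[G] (`lift_mul_lift_sub_mem`).

Send a bar chain [g|h] to (σ(g) - 1)(σ(h) - 1) for a section σ. The relation σ(g)σ(h) = f(g,h)σ(gh)
with the factor set f shows that a 2-cycle x goes to κ(x) - 1 modulo 𝔠𝔢 (`barLift_sub_kappa_mem`).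

Modulo 𝔠𝔢 + 𝔢^{m+2}, where n = m + 2, the product of lifts is a balanced pairing of 𝔤/𝔤^{m+1} with
𝔤/𝔤^{m+2}, hence kills the boundaries of P_mB_3. So ρ(x) = 0 forces κ(x) - 1 ∈ 𝔠𝔢 + 𝔢^n
(`kappa_mem_relPow`).

Conversely, let c - 1 = w + u with w ∈ 𝔠𝔢 and u ∈ 𝔢^{m+1}𝔢. Projecting the factors of u to ℤ[G]
gives a bar chain that is already zero in P_mB_2 and whose boundary is minus the image of u, which
is 0. This chain is a cycle in Ker ρ, and the embedding of C identifies its κ with c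
(`exists_kappa_eq`). -/

theorem groupAug_eq_zero_of_mem {G : Type*} [Group G] {a : MonoidAlgebra ℤ G}
    (ha : a ∈ aug (groupAug ℤ G)) : groupAug ℤ G a = 0 := ha

theorem of_sub_one_mem_subAug {E : Type*} [Group E] {N : Subgroup E} {x : E} (hx : x ∈ N) :
    of ℤ E x - 1 ∈ subAug N := by
  refine ⟨gSub ℤ (⟨x, hx⟩ : N), (gSub ℤ (⟨x, hx⟩ : N)).2, ?_⟩
  change mapDomainAlgHom ℤ ℤ N.subtype (of ℤ N ⟨x, hx⟩ - 1) = _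
  rw [map_sub, map_one]
  simp

variable {C G : Type} {E : Type*} [CommGroup C] [Group E] [Group G] (S : GroupExtension C E G)

/-- The ring homomorphism `ℤ[E] → ℤ[G]` of a group extension. -/
abbrev groupRingProj : MonoidAlgebra ℤ E →ₐ[ℤ] MonoidAlgebra ℤ G :=
  mapDomainAlgHom ℤ ℤ S.rightHom

/-- The additive section `ℤ[G] → ℤ[E]` given by a section of the extension. -/
abbrev groupRingSection (σ : S.Section) : MonoidAlgebra ℤ G →ₗ[ℤ] MonoidAlgebra ℤ E :=
  mapDomainLinearMap ℤ ℤ σ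

/-- The product `𝔠𝔢` in `ℤ[E]`. -/
abbrev kernelMulAug : Submodule ℤ (MonoidAlgebra ℤ E) :=
  subAug S.inl.range * aug (groupAug ℤ E)

variable {S}

theorem groupAug_groupRingProj (x : MonoidAlgebra ℤ E) :
    groupAug ℤ G (groupRingProj S x) = groupAug ℤ E x := by
  induction x using MonoidAlgebra.induction_linear with
  | zero => simp
  | add x y hx hy => simp only [map_add, hx, hy]
  | single e z => simp

theorem groupAug_groupRingSection (σ : S.Section) (x : MonoidAlgebra ℤ G) :
    groupAug ℤ E (groupRingSection S σ x) = groupAug ℤ G x := by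
  induction x using MonoidAlgebra.induction_linear with
  | zero => simp
  | add x y hx hy => simp only [map_add, hx, hy]
  | single e z => simp

theorem groupRingProj_groupRingSection (σ : S.Section) (x : MonoidAlgebra ℤ G) :
    groupRingProj S (groupRingSection S σ x) = x := by
  induction x using MonoidAlgebra.induction_linear with
  | zero => simp
  | add x y hx hy => simp only [map_add, hx, hy]
  | single e z => simp

theorem groupRingSection_mem_aug (σ : S.Section) {a : MonoidAlgebra ℤ G}
    (ha : a ∈ aug (groupAug ℤ G)) : groupRingSection S σ a ∈ aug (groupAug ℤ E) :=
  (groupAug_groupRingSection σ a).trans ha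

theorem groupRingProj_mem_aug {a : MonoidAlgebra ℤ E}
    (ha : a ∈ aug (groupAug ℤ E)) : groupRingProj S a ∈ aug (groupAug ℤ G) :=
  (groupAug_groupRingProj a).trans ha

/-- The kernel of `ℤ[E] → ℤ[G]` is spanned by the elements `(c - 1)e`. -/
theorem mem_span_of_groupRingProj_eq_zero {y : MonoidAlgebra ℤ E} (hy : groupRingProj S y = 0) :
    y ∈ Submodule.span ℤ {t | ∃ (c : C) (e : E), t = (of ℤ E (S.inl c) - 1) * of ℤ E e} := by
  set σ := someSection S
  -- The difference x - σ(π(x)) is additive in x, so basis elements suffice; on the kernel of π it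
  -- is x itself.
  have key : ∀ x : MonoidAlgebra ℤ E, x - groupRingSection S σ (groupRingProj S x) ∈
      Submodule.span ℤ {t | ∃ (c : C) (e : E), t = (of ℤ E (S.inl c) - 1) * of ℤ E e} := by
    intro x
    induction x using MonoidAlgebra.induction_linear with
    | zero => simp
    | add x y hx hy =>
      rw [map_add, map_add, add_sub_add_comm]
      exact add_mem hx hy
    | single e z =>
      obtain ⟨c, hc⟩ : e * (σ (S.rightHom e))⁻¹ ∈ S.inl.range := by
        rw [S.range_inl_eq_ker_rightHom, MonoidHom.mem_ker]
        simp
      have h : single e z - groupRingSection S σ (groupRingProj S (single e z)) =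
          z • ((of ℤ E (S.inl c) - 1) * of ℤ E (σ (S.rightHom e))) := by
        rw [sub_mul, ← map_mul, hc]
        simp [smul_sub]
      rw [h]
      exact Submodule.smul_mem _ _ (Submodule.subset_span ⟨_, _, rfl⟩)
  simpa [hy] using key y

/-- The kernel is 𝔠ℤ[E], and ℤ[E]𝔢 ⊆ 𝔢. -/
theorem mul_mem_kernelMulAug {y w : MonoidAlgebra ℤ E} (hy : groupRingProj S y = 0)
    (hw : w ∈ aug (groupAug ℤ E)) : y * w ∈ kernelMulAug S := by
  have hy' := mem_span_of_groupRingProj_eq_zero hy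
  clear hy
  induction hy' using Submodule.span_induction with
  | zero => simp
  | add x y _ _ hx hy => rw [add_mul]; exact add_mem hx hy
  | smul z x _ hx => rw [smul_mul_assoc]; exact Submodule.smul_mem _ _ hx
  | mem x hx =>
    obtain ⟨c, e, rfl⟩ := hx
    rw [mul_assoc]
    exact Submodule.mul_mem_mul (of_sub_one_mem_subAug ⟨c, rfl⟩)
      ((augIdeal (groupAug ℤ E)).mul_mem_left _ hw)

theorem of_commute_of_mem_center {c : E} (hc : c ∈ Subgroup.center E) (w : MonoidAlgebra ℤ E) :
    w * of ℤ E c = of ℤ E c * w := by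
  induction w using MonoidAlgebra.induction_linear with
  | zero => simp
  | add x y hx hy => rw [add_mul, mul_add, hx, hy]
  | single e z => simp [single_mul_single, Subgroup.mem_center_iff.1 hc e]

/-- Centrality enters here: w(c - 1)e = (c - 1)we, and we ∈ 𝔢. -/
theorem mul_mem_kernelMulAug' (hC : S.inl.range ≤ Subgroup.center E) {y w : MonoidAlgebra ℤ E}
    (hy : groupRingProj S y = 0) (hw : w ∈ aug (groupAug ℤ E)) : w * y ∈ kernelMulAug S := by
  have hy' := mem_span_of_groupRingProj_eq_zero hy
  clear hy
  induction hy' using Submodule.span_induction with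
  | zero => simp
  | add x y _ _ hx hy => rw [mul_add]; exact add_mem hx hy
  | smul z x _ hx => rw [mul_smul_comm]; exact Submodule.smul_mem _ _ hx
  | mem x hx =>
    obtain ⟨c, e, rfl⟩ := hx
    rw [← mul_assoc, mul_sub, of_commute_of_mem_center (hC ⟨c, rfl⟩), mul_one, ← sub_one_mul,
      mul_assoc]
    exact Submodule.mul_mem_mul (of_sub_one_mem_subAug ⟨c, rfl⟩)
      ((augIdeal (groupAug ℤ E)).mul_mem_right _ hw)

theorem groupRingProj_eq_zero_of_mem {y : MonoidAlgebra ℤ E} (hy : y ∈ kernelMulAug S) :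
    groupRingProj S y = 0 := by
  induction hy using Submodule.mul_induction_on' with
  | add x _ y _ hx hy => rw [map_add, hx, hy, add_zero]
  | mem_mul_mem x hx y _ =>
    suffices h : groupRingProj S x = 0 by rw [map_mul, h, zero_mul]
    obtain ⟨a, ha, rfl⟩ := hx
    -- Elements of C are not in the augmentation ideal, so the induction runs over all of ℤ[C],
    -- where the projection is the augmentation.
    have key : ∀ b : MonoidAlgebra ℤ S.inl.range,
        groupRingProj S (mapDomainAlgHom ℤ ℤ S.inl.range.subtype b) =
          groupAug ℤ _ b • 1 := by
      intro b
      induction b using MonoidAlgebra.induction_linear with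
      | zero => simp
      | add x y hx hy => simp only [map_add, hx, hy, add_smul]
      | single e z =>
        obtain ⟨_, c, rfl⟩ := e
        simp [one_def]
    exact (key a).trans (by rw [groupAug_eq_zero_of_mem ha, zero_smul])

/-- The lift is built factor by factor: the additive section is not multiplicative and need not
preserve powers. -/
theorem exists_mem_pow_groupRingProj_eq (k : ℕ) {a : MonoidAlgebra ℤ G}
    (ha : a ∈ augIdeal (groupAug ℤ G) ^ k) :
    ∃ b ∈ augIdeal (groupAug ℤ E) ^ k, groupRingProj S b = a := by
  induction k generalizing a with
  | zero =>
    refine ⟨groupRingSection S (someSection S) a, ?_, groupRingProj_groupRingSection _ _⟩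
    rw [Submodule.pow_zero, Ideal.one_eq_top]
    trivial
  | succ k ih =>
    rw [Submodule.pow_succ] at ha
    refine Submodule.smul_induction_on ha ?_ ?_
    · intro p hp q hq
      obtain ⟨b, hb, rfl⟩ := ih hp
      refine ⟨b * groupRingSection S (someSection S) q, ?_, ?_⟩
      · rw [Submodule.pow_succ]
        exact Ideal.mul_mem_mul hb (groupRingSection_mem_aug _ hq)
      · rw [map_mul, groupRingProj_groupRingSection]
        rfl
    · rintro x y ⟨b, hb, rfl⟩ ⟨b', hb', rfl⟩
      exact ⟨b + b', add_mem hb hb', map_add _ _ _⟩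

theorem groupRingProj_mem_pow (k : ℕ) {b : MonoidAlgebra ℤ E}
    (hb : b ∈ augIdeal (groupAug ℤ E) ^ k) :
    groupRingProj S b ∈ augIdeal (groupAug ℤ G) ^ k := by
  induction k generalizing b with
  | zero =>
    rw [Submodule.pow_zero, Ideal.one_eq_top]
    trivial
  | succ k ih =>
    rw [Submodule.pow_succ] at hb ⊢
    refine Submodule.smul_induction_on hb ?_ ?_
    · intro p hp q hq
      rw [smul_eq_mul, map_mul]
      exact Ideal.mul_mem_mul (ih hp) (groupRingProj_mem_aug hq)
    · intro x y hx hy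
      rw [map_add]
      exact add_mem hx hy

/-! ### The embedding of C into ℤ[E]/𝔠𝔢. -/

variable (S) in
/-- The `C`-coordinate of an element of `E` with respect to a section, extended to `ℤ[E]`. -/
theorem exists_coordinate :
    ∃ φ : MonoidAlgebra ℤ E →ₗ[ℤ] Additive C,
      (∀ x ∈ kernelMulAug S, φ x = 0) ∧
        ∀ c : C, φ (of ℤ E (S.inl c) - 1) = Additive.ofMul c := by
  have h : ∀ e : E, ∃ c : C, S.inl c = e * (someSection S (S.rightHom e))⁻¹ := fun e => by
    change _ ∈ S.inl.range
    rw [S.range_inl_eq_ker_rightHom, MonoidHom.mem_ker]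
    simp
  choose u hu using h
  have hmul : ∀ (c : C) (e : E), u (S.inl c * e) = c * u e := fun c e => by
    apply S.inl_injective
    rw [map_mul, hu, hu, map_mul, S.rightHom_inl, one_mul, mul_assoc]
  let φ : MonoidAlgebra ℤ E →ₗ[ℤ] Additive C :=
    Finsupp.linearCombination ℤ (fun e => Additive.ofMul (u e)) ∘ₗ
      (coeffLinearEquiv ℤ).toLinearMap
  have hφ : ∀ e z, φ (single e z) = z • Additive.ofMul (u e) := fun e z => by simp [φ]
  -- This formula serves twice: it gives 0 for w ∈ 𝔢 and recovers c for w = 1.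
  have hφ' : ∀ (c : C) (w : MonoidAlgebra ℤ E),
      φ ((of ℤ E (S.inl c) - 1) * w) = groupAug ℤ E w • Additive.ofMul c := by
    intro c w
    induction w using MonoidAlgebra.induction_linear with
    | zero => simp
    | add x y hx hy => simp only [mul_add, map_add, hx, hy, add_smul]
    | single e z =>
      rw [sub_mul, one_mul, of_apply, single_mul_single, one_mul, map_sub, hφ, hφ, hmul,
        ofMul_mul, groupAug_single, smul_add, add_sub_cancel_right]
  refine ⟨φ, fun x hx => ?_, fun c => ?_⟩
  · induction hx using Submodule.mul_induction_on' with
    | add x _ y _ hx hy => rw [map_add, hx, hy, add_zero]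
    | mem_mul_mem x hx y hy =>
      obtain ⟨a, ha, rfl⟩ := hx
      have key : ∀ b : MonoidAlgebra ℤ S.inl.range,
          φ ((mapDomainAlgHom ℤ ℤ S.inl.range.subtype b -
            groupAug ℤ _ b • 1) * y) = 0 := by
        intro b
        induction b using MonoidAlgebra.induction_linear with
        | zero => simp
        | add b b' hb hb' =>
          rw [map_add, map_add, add_smul, add_sub_add_comm, add_mul, map_add, hb, hb', add_zero]
        | single e z =>
          obtain ⟨_, c, rfl⟩ := e
          have : mapDomainAlgHom ℤ ℤ S.inl.range.subtype (single ⟨S.inl c, c, rfl⟩ z) -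
              groupAug ℤ _ (single (⟨S.inl c, c, rfl⟩ : S.inl.range) z) •
                (1 : MonoidAlgebra ℤ E) =
              z • (of ℤ E (S.inl c) - 1) := by
            simp [smul_sub, one_def]
          rw [this, smul_mul_assoc, map_smul, hφ', groupAug_eq_zero_of_mem hy, zero_smul,
            smul_zero]
      have := key a
      rwa [groupAug_eq_zero_of_mem ha, zero_smul, sub_zero] at this
  · have := hφ' c 1
    rwa [mul_one, map_one, one_smul] at this

/-- The coordinate map is a left inverse of c ↦ c - 1 on ℤ[E]/𝔠𝔢. -/
theorem eq_of_sub_mem_kernelMulAug {c c' : C}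
    (h : (of ℤ E (S.inl c) - 1) - (of ℤ E (S.inl c') - 1) ∈ kernelMulAug S) : c = c' := by
  obtain ⟨φ, h0, h1⟩ := exists_coordinate S
  have := h0 _ h
  rw [map_sub, h1, h1, sub_eq_zero] at this
  exact Additive.ofMul.injective this

variable (S) in
/-- The additive map `C → ℤ[E] / 𝔠𝔢`, `c ↦ c - 1`. -/
def kernelToQuotient : Additive C →+ MonoidAlgebra ℤ E ⧸ kernelMulAug S where
  toFun c := Submodule.Quotient.mk (of ℤ E (S.inl c.toMul) - 1)
  map_zero' := by rw [toMul_zero, map_one, map_one, sub_self, Submodule.Quotient.mk_zero]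
  map_add' c d := by
    rw [← Submodule.Quotient.mk_add, Submodule.Quotient.eq]
    have h : of ℤ E (S.inl (c + d).toMul) - 1 -
        (of ℤ E (S.inl c.toMul) - 1 + (of ℤ E (S.inl d.toMul) - 1)) =
          (of ℤ E (S.inl c.toMul) - 1) * (of ℤ E (S.inl d.toMul) - 1) := by
      rw [toMul_add, map_mul, map_mul]
      noncomm_ring
    rw [h]
    exact Submodule.mul_mem_mul (of_sub_one_mem_subAug ⟨_, rfl⟩) (gSub ℤ (S.inl d.toMul)).2

/-! ### Lifting bar chains to ℤ[E]. -/

/-- The map on bar chains `[g|h] ↦ (σ(g) - 1)(σ(h) - 1)`. -/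
def barLift (σ : S.Section) : (G × G →₀ ℤ) →ₗ[ℤ] MonoidAlgebra ℤ E :=
  Finsupp.linearCombination ℤ fun g => (of ℤ E (σ g.1) - 1) * (of ℤ E (σ g.2) - 1)

/-- With f the factor set, the two sides differ on [g|h] by (f(g,h) - 1)(σ(gh) - 1) ∈ 𝔠𝔢. The
correction term is a function of the boundary alone, so it disappears on cycles. -/
theorem mk_barLift (hC : S.inl.range ≤ Subgroup.center E) (σ : S.Section) (x : G × G →₀ ℤ) :
    (Submodule.Quotient.mk (barLift σ x) : MonoidAlgebra ℤ E ⧸ kernelMulAug S) =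
      kernelToQuotient S (Finsupp.linearCombination ℤ
        ((extCocycle S hC σ).1 : G × G → Additive C) x) -
      Submodule.Quotient.mk (Finsupp.linearCombination ℤ (fun g => of ℤ E (σ g) - 1)
        ((groupHomology.d₂₁ (Rep.trivial ℤ G ℤ)).hom x)) := by
  induction x using Finsupp.induction_linear with
  | zero => simp
  | add x y hx hy =>
    simp only [map_add, Submodule.Quotient.mk_add, hx, hy]
    abel
  | single g z =>
    obtain ⟨g, h⟩ := g
    have hd := groupHomology.d₂₁_single (A := Rep.trivial ℤ G ℤ) (g, h) z
    rw [hd]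
    simp only [barLift, Finsupp.linearCombination_single, map_sub, map_add, map_zsmul,
      Representation.trivial_apply]
    rw [← smul_sub, ← smul_add, Submodule.Quotient.mk_smul, Submodule.Quotient.mk_smul,
      ← smul_sub]
    congr 1
    change _ = Submodule.Quotient.mk (of ℤ E (S.inl (factorSet S σ g h)) - 1) - _
    rw [← Submodule.Quotient.mk_sub, Submodule.Quotient.eq]
    have e : of ℤ E (σ g) * of ℤ E (σ h) =
        of ℤ E (S.inl (factorSet S σ g h)) * of ℤ E (σ (g * h)) := by
      rw [← map_mul (of ℤ E), ← map_mul (of ℤ E), inl_factorSet, inv_mul_cancel_right]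
    have h' : (of ℤ E (σ g) - 1) * (of ℤ E (σ h) - 1) -
        (of ℤ E (S.inl (factorSet S σ g h)) - 1 -
          (of ℤ E (σ h) - 1 - (of ℤ E (σ (g * h)) - 1) + (of ℤ E (σ g) - 1))) =
        (of ℤ E (S.inl (factorSet S σ g h)) - 1) * (of ℤ E (σ (g * h)) - 1) := by
      rw [sub_mul, mul_sub, e, sub_mul, mul_sub]
      noncomm_ring
    rw [h']
    exact Submodule.mul_mem_mul (of_sub_one_mem_subAug ⟨_, rfl⟩) (gSub ℤ (σ (g * h))).2

/-- For a 2-cycle, `barLift` computes `κ - 1` modulo `𝔠𝔢`. -/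
theorem barLift_sub_kappa_mem (hC : S.inl.range ≤ Subgroup.center E) (σ : S.Section)
    (x : groupHomology.cycles₂ (Rep.trivial ℤ G ℤ)) :
    barLift σ x.1 -
      (of ℤ E (S.inl (kappa S hC (groupHomology.H2π (Rep.trivial ℤ G ℤ) x)).toMul) - 1) ∈
        kernelMulAug S := by
  have hx : (groupHomology.d₂₁ (Rep.trivial ℤ G ℤ)).hom x.1 = 0 := x.2
  have h := mk_barLift hC σ x.1
  rw [hx, map_zero, Submodule.Quotient.mk_zero, sub_zero] at h
  have hk : kappa S hC (groupHomology.H2π (Rep.trivial ℤ G ℤ) x) =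
      Finsupp.linearCombination ℤ ((extCocycle S hC σ).1 : G × G → Additive C) x.1 := by
    rw [kappa, extClass_eq S hC σ]
    exact kronecker_H2π ℤ _ x
  rw [← Submodule.Quotient.eq, h, hk]
  rfl

end CentralExtension

/-! ### Functionals on P_nB_2 from balanced pairings. -/

section BalPairing

variable {K A : Type*} [CommRing K] [Ring A] [Algebra K A] (ε : A →ₐ[K] K)
variable {Q : Type*} [AddCommGroup Q] [Module K Q]

/-- The map `P_n B_2 → Q`, `a₀ ⊗ a₁ ⊗ a₂ ↦ ε(a₀)p(a₁, a₂)`, given by a bilinear pairing `p`. -/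
def b2Pairing (n : ℕ) (p : TruncAug ε n →ₗ[K] TruncAug ε (n + 1) →ₗ[K] Q) : B2 ε n →ₗ[K] Q :=
  TensorProduct.lift ((LinearMap.lsmul K _).compl₁₂ (truncEps ε n).toLinearMap
    (TensorProduct.lift p))

theorem b2Pairing_tmul (n : ℕ) (p : TruncAug ε n →ₗ[K] TruncAug ε (n + 1) →ₗ[K] Q)
    (a : TruncAlg ε n) (v : TruncAug ε n ⊗[K] TruncAug ε (n + 1)) :
    b2Pairing ε n p (a ⊗ₜ v) = truncEps ε n a • TensorProduct.lift p v := rfl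

theorem b2Pairing_smul (n : ℕ) (p : TruncAug ε n →ₗ[K] TruncAug ε (n + 1) →ₗ[K] Q)
    (r : TruncAlg ε n) (x : B2 ε n) :
    b2Pairing ε n p (r • x) = truncEps ε n r • b2Pairing ε n p x := by
  induction x using TensorProduct.induction_on with
  | zero => simp
  | add x y hx hy => rw [smul_add, map_add, map_add, smul_add, hx, hy]
  | tmul a v =>
    rw [TensorProduct.smul_tmul', b2Pairing_tmul, b2Pairing_tmul, smul_eq_mul, map_mul, mul_smul]

/-- The map `K ⊗ P_n B_2 → Q` induced by `b2Pairing`. -/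
def balPairing (n : ℕ) (p : TruncAug ε n →ₗ[K] TruncAug ε (n + 1) →ₗ[K] Q) :
    Bal ε n (B2 ε n) →ₗ[K] Q :=
  Submodule.liftQ _ (TensorProduct.lift ((LinearMap.lsmul K _).compl₁₂ LinearMap.id
    (b2Pairing ε n p))) (by
      rw [balRel, Submodule.span_le]
      rintro _ ⟨z, r, x, rfl⟩
      refine LinearMap.mem_ker.2 ?_
      rw [map_sub]
      change (z * truncEps ε n r) • b2Pairing ε n p x - z • b2Pairing ε n p (r • x) = 0
      rw [b2Pairing_smul, mul_smul, sub_self])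

theorem balPairing_balMk (n : ℕ) (p : TruncAug ε n →ₗ[K] TruncAug ε (n + 1) →ₗ[K] Q)
    (z : K) (x : B2 ε n) : balPairing ε n p (balMk ε n z x) = z • b2Pairing ε n p x := rfl

/-- `p` is balanced over `Ā`. -/
def IsBalancedPairing (n : ℕ) (p : TruncAug ε n →ₗ[K] TruncAug ε (n + 1) →ₗ[K] Q) : Prop :=
  ∀ a b c : aug ε, p (Submodule.Quotient.mk (augMul ε a b)) (Submodule.Quotient.mk c) =
    p (Submodule.Quotient.mk a) (Submodule.Quotient.mk (augMul ε b c))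

/-- The term with a₀a₁ in front dies because ε(a₁) = 0; the other two cancel by balancedness. -/
theorem b2Pairing_d3 {n : ℕ} {p : TruncAug ε n →ₗ[K] TruncAug ε (n + 1) →ₗ[K] Q}
    (hp : IsBalancedPairing ε n p) (x : B3 ε n) : b2Pairing ε n p (d3 ε n x) = 0 := by
  induction x using TensorProduct.induction_on with
  | zero => simp
  | add x y hx hy => rw [map_add, map_add, hx, hy, add_zero]
  | tmul a₀ v =>
    induction v with
    | zero => simp
    | add x y hx hy => rw [TensorProduct.tmul_add, map_add, map_add, hx, hy, add_zero]
    | tmul a₁ w =>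
      induction w with
      | zero => simp
      | add x y hx hy =>
        rw [TensorProduct.tmul_add, TensorProduct.tmul_add, map_add, map_add, hx, hy, add_zero]
      | tmul a₂ a₃ =>
        obtain ⟨a₁, rfl⟩ := Submodule.Quotient.mk_surjective _ a₁
        obtain ⟨a₂, rfl⟩ := Submodule.Quotient.mk_surjective _ a₂
        obtain ⟨a₃, rfl⟩ := Submodule.Quotient.mk_surjective _ a₃
        have h0 : truncEps ε n (truncIncl ε n (Submodule.Quotient.mk a₁)) = 0 := a₁.2
        rw [d3_tmul, map_add, map_sub, b2Pairing_tmul, b2Pairing_tmul, b2Pairing_tmul, map_mul, h0,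
          mul_zero, zero_smul, zero_sub, TensorProduct.lift.tmul, TensorProduct.lift.tmul,
          truncMul_mk, truncMul_mk, hp, neg_add_cancel]

theorem balPairing_balMap_d3 {n : ℕ} {p : TruncAug ε n →ₗ[K] TruncAug ε (n + 1) →ₗ[K] Q}
    (hp : IsBalancedPairing ε n p) (x : Bal ε n (B3 ε n)) :
    balPairing ε n p (balMap ε n (d3 ε n) x) = 0 := by
  obtain ⟨x, rfl⟩ := Submodule.Quotient.mk_surjective _ x
  induction x with
  | zero => simp
  | add x y hx hy => rw [Submodule.Quotient.mk_add, map_add, map_add, hx, hy, add_zero]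
  | tmul z x =>
    change z • b2Pairing ε n p (d3 ε n x) = 0
    rw [b2Pairing_d3 ε hp, smul_zero]

end BalPairing

/-! ### Bar chains attached to pairs of group ring elements. -/

section BarPairing

open MonoidAlgebra

/-- The bilinear map `([g], [h]) ↦ [g|h]`. -/
def barPairing (K G : Type*) [CommRing K] : MonoidAlgebra K G →ₗ[K] MonoidAlgebra K G →ₗ[K] (G × G →₀ K) :=
  (TensorProduct.mk K (G →₀ K) (G →₀ K)).compr₂ (finsuppTensorFinsupp' K G G).toLinearMap
    |>.compl₁₂ (coeffLinearEquiv K).toLinearMap (coeffLinearEquiv K).toLinearMap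

theorem barPairing_single {K G : Type*} [CommRing K] (g h : G) (y z : K) :
    barPairing K G (single g y) (single h z) = Finsupp.single (g, h) (y * z) := by
  simp [barPairing]

variable (K : Type*) [CommRing K] {G : Type*} [Group G]

theorem balPairing_rhoChain2 {Q : Type*} [AddCommGroup Q] [Module K Q] (n : ℕ)
    (p : TruncAug (groupAug K G) n →ₗ[K] TruncAug (groupAug K G) (n + 1) →ₗ[K] Q)
    (x : G × G →₀ K) :
    balPairing (groupAug K G) n p (rhoChain2 K n x) =
      Finsupp.linearCombination K (fun g : G × G => p (pcl K n g.1) (pcl K (n + 1) g.2)) x := by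
  induction x using Finsupp.induction_linear with
  | zero => rw [map_zero, map_zero, map_zero]
  | add x y hx hy => rw [map_add, map_add, map_add, hx, hy]
  | single g z =>
    rw [rhoChain2, Finsupp.lsum_single, balLin_apply, balPairing_balMk, gen2, b2Pairing_tmul,
      map_one, one_smul, TensorProduct.lift.tmul, Finsupp.linearCombination_single]

variable (G) in
/-- The projection `a ↦ a - ε(a)` onto the augmentation ideal. -/
def augProj : MonoidAlgebra K G →ₗ[K] aug (groupAug K G) :=
  LinearMap.codRestrict _ (LinearMap.id - (Algebra.linearMap K (MonoidAlgebra K G)) ∘ₗ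
    (groupAug K G).toLinearMap) fun a => by
      change groupAug K G (a - algebraMap K _ (groupAug K G a)) = 0
      rw [map_sub, AlgHom.commutes]
      exact sub_self _

theorem augProj_single (g : G) (z : K) : augProj K G (single g z) = z • gSub K g := by
  apply Subtype.ext
  change single g z - algebraMap K _ (groupAug K G (single g z)) = z • (of K G g - 1)
  rw [groupAug_single, Algebra.algebraMap_eq_smul_one, smul_sub]
  simp

theorem augProj_coe (a : aug (groupAug K G)) : augProj K G a = a := by
  apply Subtype.ext
  change (a : MonoidAlgebra K G) - algebraMap K _ (groupAug K G a) = a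
  rw [show groupAug K G (a : MonoidAlgebra K G) = 0 from a.2, map_zero, sub_zero]

/-- Projecting to the augmentation ideal makes the formula meaningful on all of K[G], so that it can
be checked on group elements. -/
theorem rhoChain2_barPairing' (n : ℕ) (a b : MonoidAlgebra K G) :
    rhoChain2 K n (barPairing K G a b) =
      balMk _ n 1 (1 ⊗ₜ (Submodule.Quotient.mk (augProj K G a) ⊗ₜ
        Submodule.Quotient.mk (augProj K G b))) := by
  induction a using MonoidAlgebra.induction_linear with
  | zero => simp [balMk]
  | add x y hx hy =>
    rw [map_add, LinearMap.add_apply, map_add, map_add, hx, hy, Submodule.Quotient.mk_add,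
      TensorProduct.add_tmul, TensorProduct.tmul_add, balMk_add_right]
  | single g z =>
    induction b using MonoidAlgebra.induction_linear with
    | zero => simp [balMk]
    | add x y hx hy =>
      rw [map_add, map_add, map_add, hx, hy, Submodule.Quotient.mk_add,
        TensorProduct.tmul_add, TensorProduct.tmul_add, balMk_add_right]
    | single h w =>
      rw [barPairing_single, augProj_single, augProj_single, Submodule.Quotient.mk_smul,
        Submodule.Quotient.mk_smul, rhoChain2, Finsupp.lsum_single, balLin_apply, gen2]
      rw [TensorProduct.smul_tmul_smul, TensorProduct.tmul_smul]
      have h1 : z * w = (z * w) • (1 : K) := by rw [smul_eq_mul, mul_one]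
      rw [h1, balMk, TensorProduct.smul_tmul, ← h1]
      rfl

theorem rhoChain2_barPairing (n : ℕ) (a b : aug (groupAug K G)) :
    rhoChain2 K n (barPairing K G a b) =
      balMk _ n 1 (1 ⊗ₜ (Submodule.Quotient.mk a ⊗ₜ Submodule.Quotient.mk b)) := by
  rw [rhoChain2_barPairing', augProj_coe, augProj_coe]

theorem rhoChain2_barPairing_eq_zero (n : ℕ) (a b : aug (groupAug K G))
    (ha : (a : MonoidAlgebra K G) ∈ augIdeal (groupAug K G) ^ (n + 1)) :
    rhoChain2 K n (barPairing K G a b) = 0 := by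
  have h : (Submodule.Quotient.mk a : TruncAug (groupAug K G) n) = 0 :=
    (Submodule.Quotient.mk_eq_zero _).2 ha
  rw [rhoChain2_barPairing, h]
  simp [balMk]

end BarPairing

/-! ### Products of lifts modulo 𝔠𝔢 and the two inclusions. -/

section Comparison

open MonoidAlgebra

variable {C G : Type} {E : Type*} [CommGroup C] [Group E] [Group G] {S : GroupExtension C E G}

/-- Modulo `𝔠𝔢`, the product of two elements of `𝔢` depends only on their images in `ℤ[G]`. -/
theorem lift_mul_lift_sub_mem (hC : S.inl.range ≤ Subgroup.center E)
    {p p' q q' : MonoidAlgebra ℤ E} (hp : groupRingProj S p = groupRingProj S p')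
    (hq : groupRingProj S q = groupRingProj S q') (hp' : p' ∈ aug (groupAug ℤ E))
    (hq' : q ∈ aug (groupAug ℤ E)) : p * q - p' * q' ∈ kernelMulAug S := by
  have h : p * q - p' * q' = (p - p') * q + p' * (q - q') := by noncomm_ring
  rw [h]
  exact add_mem (mul_mem_kernelMulAug (by rw [map_sub, hp, sub_self]) hq')
    (mul_mem_kernelMulAug' hC (by rw [map_sub, hq, sub_self]) hp')

theorem kernelMulAug_le_relPow (n : ℕ) : kernelMulAug S ≤ relPow n S.inl.range := le_sup_left

/-- Modulo 𝔠𝔢 the lifts σ(a), σ(b) may be replaced by any others in 𝔢, in particular by a lift lying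
in the required power of 𝔢. When a ∈ 𝔤^{m+1}, the lift of b supplies the remaining factor of 𝔢. -/
theorem section_mul_section_mem_relPow (hC : S.inl.range ≤ Subgroup.center E) (σ : S.Section)
    {m : ℕ} {a b : MonoidAlgebra ℤ G} (ha : a ∈ aug (groupAug ℤ G)) (hb : b ∈ aug (groupAug ℤ G))
    (h : a ∈ augIdeal (groupAug ℤ G) ^ (m + 1) ∨ b ∈ augIdeal (groupAug ℤ G) ^ (m + 2)) :
    groupRingSection S σ a * groupRingSection S σ b ∈ relPow (m + 2) S.inl.range := by
  obtain ⟨p, q, hp, hq, hpa, hqa, hpq⟩ : ∃ p q : MonoidAlgebra ℤ E,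
      groupRingProj S p = a ∧ groupRingProj S q = b ∧ p ∈ aug (groupAug ℤ E) ∧
        q ∈ aug (groupAug ℤ E) ∧ p * q ∈ augIdeal (groupAug ℤ E) ^ (m + 2) := by
    rcases h with h | h
    · obtain ⟨p, hp, rfl⟩ := exists_mem_pow_groupRingProj_eq (S := S) _ h
      refine ⟨p, groupRingSection S σ b, rfl, groupRingProj_groupRingSection _ _,
        Ideal.pow_le_self (Nat.succ_ne_zero m) hp, groupRingSection_mem_aug _ hb, ?_⟩
      rw [Submodule.pow_succ]
      exact Ideal.mul_mem_mul hp (groupRingSection_mem_aug σ hb)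
    · obtain ⟨q, hq, rfl⟩ := exists_mem_pow_groupRingProj_eq (S := S) _ h
      exact ⟨groupRingSection S σ a, q, groupRingProj_groupRingSection _ _, rfl,
        groupRingSection_mem_aug _ ha, Ideal.pow_le_self (Nat.succ_ne_zero _) hq,
        Ideal.mul_mem_left _ _ hq⟩
  have h1 : groupRingSection S σ a * groupRingSection S σ b - p * q ∈ kernelMulAug S :=
    lift_mul_lift_sub_mem hC (by rw [groupRingProj_groupRingSection, hp])
      (by rw [groupRingProj_groupRingSection, hq]) hpa (groupRingSection_mem_aug _ hb)
  rw [← sub_add_cancel (groupRingSection S σ a * groupRingSection S σ b) (p * q)]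
  exact Submodule.add_mem_sup h1 hpq

/-- The pairing `(a, b) ↦ σ(a)σ(b)` on the augmentation ideal of `ℤ[G]`, with values in
`ℤ[E] / (𝔠𝔢 + 𝔢ⁿ)`. -/
def sectionPairing (σ : S.Section) (n : ℕ) : aug (groupAug ℤ G) →ₗ[ℤ] aug (groupAug ℤ G) →ₗ[ℤ]
    MonoidAlgebra ℤ E ⧸ relPow n S.inl.range :=
  ((LinearMap.mul ℤ (MonoidAlgebra ℤ E)).compl₁₂ (groupRingSection S σ ∘ₗ Submodule.subtype _)
    (groupRingSection S σ ∘ₗ Submodule.subtype _)).compr₂ (Submodule.mkQ _)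

theorem sectionPairing_apply (σ : S.Section) (n : ℕ) (a b : aug (groupAug ℤ G)) :
    sectionPairing σ n a b =
      Submodule.Quotient.mk (groupRingSection S σ a * groupRingSection S σ b) := rfl

/-- Although σ is not multiplicative, σ(ab) and σ(a)σ(b) have the same image in ℤ[G]. Both sides are
therefore congruent to σ(a)σ(b)σ(c) modulo 𝔠𝔢. -/
theorem sectionPairing_augMul (hC : S.inl.range ≤ Subgroup.center E) (σ : S.Section) (n : ℕ)
    (a b c : aug (groupAug ℤ G)) :
    sectionPairing σ n (augMul _ a b) c = sectionPairing σ n a (augMul _ b c) := by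
  rw [sectionPairing_apply, sectionPairing_apply, Submodule.Quotient.eq]
  refine kernelMulAug_le_relPow n ?_
  have hm : ∀ x y : MonoidAlgebra ℤ G, groupRingProj S (groupRingSection S σ (x * y)) =
      groupRingProj S (groupRingSection S σ x * groupRingSection S σ y) := fun x y => by
    rw [map_mul (groupRingProj S)]
    simp only [groupRingProj_groupRingSection]
  have ha := groupRingSection_mem_aug σ a.2
  have hb := groupRingSection_mem_aug σ b.2
  have hc := groupRingSection_mem_aug σ c.2
  have h1 := lift_mul_lift_sub_mem hC (hm a b) rfl (Ideal.mul_mem_left _ _ hb) hc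
  have h2 := lift_mul_lift_sub_mem hC rfl (hm b c).symm ha (Ideal.mul_mem_left _ _ hc)
  rw [mul_assoc] at h1
  simpa using add_mem h1 h2

/-- The pairing of truncated augmentation ideals induced by `sectionPairing`. -/
def truncPairing (hC : S.inl.range ≤ Subgroup.center E) (σ : S.Section) (m : ℕ) :
    TruncAug (groupAug ℤ G) m →ₗ[ℤ] TruncAug (groupAug ℤ G) (m + 1) →ₗ[ℤ]
      MonoidAlgebra ℤ E ⧸ relPow (m + 2) S.inl.range :=
  (Submodule.liftQ _ (Submodule.liftQ _ (sectionPairing σ (m + 2)) (fun a ha =>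
    LinearMap.mem_ker.2 (LinearMap.ext fun b => (Submodule.Quotient.mk_eq_zero _).2
      (section_mul_section_mem_relPow hC σ a.2 b.2 (Or.inl ha))))).flip (fun b hb =>
    LinearMap.mem_ker.2 (LinearMap.ext fun a => by
      obtain ⟨a, rfl⟩ := Submodule.Quotient.mk_surjective _ a
      exact (Submodule.Quotient.mk_eq_zero _).2
        (section_mul_section_mem_relPow hC σ a.2 b.2 (Or.inr hb))))).flip

theorem truncPairing_mk (hC : S.inl.range ≤ Subgroup.center E) (σ : S.Section) (m : ℕ)
    (a b : aug (groupAug ℤ G)) :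
    truncPairing hC σ m (Submodule.Quotient.mk a) (Submodule.Quotient.mk b) =
      sectionPairing σ (m + 2) a b := rfl

theorem isBalancedPairing_truncPairing (hC : S.inl.range ≤ Subgroup.center E) (σ : S.Section)
    (m : ℕ) : IsBalancedPairing (groupAug ℤ G) m (truncPairing hC σ m) := fun a b c =>
  sectionPairing_augMul hC σ (m + 2) a b c

/-- The normalisation σ(1) = 1 is what makes the linear extension of σ send g - 1 to σ(g) - 1. -/
theorem linearCombination_truncPairing (hC : S.inl.range ≤ Subgroup.center E) (σ : S.Section)
    (hσ : σ 1 = 1) (m : ℕ) (x : G × G →₀ ℤ) :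
    Finsupp.linearCombination ℤ (fun g : G × G =>
      truncPairing hC σ m (pcl ℤ m g.1) (pcl ℤ (m + 1) g.2)) x =
        Submodule.Quotient.mk (barLift σ x) := by
  induction x using Finsupp.induction_linear with
  | zero => simp
  | add x y hx hy => rw [map_add, map_add, Submodule.Quotient.mk_add, hx, hy]
  | single g z =>
    have hs : ∀ g : G, groupRingSection S σ (gSub ℤ g) = of ℤ E (σ g) - 1 := fun g => by
      change groupRingSection S σ (of ℤ G g - 1) = _
      simp [one_def, hσ]
    rw [Finsupp.linearCombination_single, pcl, pcl, truncPairing_mk, sectionPairing_apply, hs, hs,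
      barLift, Finsupp.linearCombination_single]
    rfl

theorem barLift_mem_relPow (hC : S.inl.range ≤ Subgroup.center E) (σ : S.Section) (hσ : σ 1 = 1)
    (m : ℕ) (x : G × G →₀ ℤ)
    (hx : rhoChain2 ℤ m x ∈ LinearMap.range (balMap _ m (d3 (groupAug ℤ G) m))) :
    barLift σ x ∈ relPow (m + 2) S.inl.range := by
  obtain ⟨y, hy⟩ := hx
  have h := balPairing_balMap_d3 _ (isBalancedPairing_truncPairing hC σ m) y
  rw [← Submodule.Quotient.mk_eq_zero, ← linearCombination_truncPairing hC σ hσ]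
  exact (balPairing_rhoChain2 ℤ m _ x).symm.trans ((congrArg _ hy.symm).trans h)

/-- The linear extension of g ↦ σ(g) - 1 is a ↦ σ(a) - ε(a). On augmentation ideals the corrections
vanish, so no normalisation of σ is needed. -/
theorem barLift_barPairing (σ : S.Section) (a b : MonoidAlgebra ℤ G) :
    barLift σ (barPairing ℤ G a b) =
      (groupRingSection S σ a - groupAug ℤ G a • 1) *
        (groupRingSection S σ b - groupAug ℤ G b • 1) := by
  induction a using MonoidAlgebra.induction_linear with
  | zero => simp
  | add x y hx hy =>
    simp only [map_add, LinearMap.add_apply, hx, hy, add_smul]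
    rw [add_sub_add_comm, add_mul]
  | single g z =>
    induction b using MonoidAlgebra.induction_linear with
    | zero => simp
    | add x y hx hy =>
      simp only [map_add, hx, hy, add_smul]
      rw [add_sub_add_comm, mul_add]
    | single h w =>
      have hs : ∀ (g : G) (z : ℤ), groupRingSection S σ (single g z) -
          groupAug ℤ G (single g z) • 1 = z • (of ℤ E (σ g) - 1) := fun g z => by
        simp [smul_sub]
      rw [barPairing_single, hs, hs, barLift, Finsupp.linearCombination_single,
        smul_mul_smul_comm]

/-- For a and b in the augmentation ideal only -ab survives, which makes the boundary of a lifted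
chain computable. -/
theorem d₂₁_barPairing (a b : MonoidAlgebra ℤ G) :
    (groupHomology.d₂₁ (Rep.trivial ℤ G ℤ)).hom (barPairing ℤ G a b) =
      groupAug ℤ G a • b.coeff - (a * b).coeff + groupAug ℤ G b • a.coeff := by
  induction a using MonoidAlgebra.induction_linear with
  | zero => simp
  | add x y hx hy =>
    simp only [map_add, LinearMap.add_apply, hx, hy, add_smul, add_mul, coeff_add, smul_add]
    abel
  | single g z =>
    induction b using MonoidAlgebra.induction_linear with
    | zero => simp
    | add x y hx hy =>
      simp only [map_add, hx, hy, add_smul, mul_add, coeff_add, smul_add]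
      abel
    | single h w =>
      rw [barPairing_single]
      refine (groupHomology.d₂₁_single (A := Rep.trivial ℤ G ℤ) (g, h) (z * w)).trans ?_
      simp [single_mul_single, mul_comm w z]

variable (S) in
theorem exists_section_one : ∃ σ : S.Section, σ 1 = 1 := by
  classical
  refine ⟨⟨fun g => if g = 1 then 1 else someSection S g, fun g => ?_⟩, if_pos rfl⟩
  change S.rightHom (if g = 1 then 1 else someSection S g) = g
  split_ifs with h
  · rw [map_one, h]
  · exact (someSection S).rightInverse_rightHom g

theorem kappa_mem_relPow (hC : S.inl.range ≤ Subgroup.center E) (m : ℕ) (x : H2Z G)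
    (hx : rho m G x = 0) :
    of ℤ E (S.inl (kappa S hC x).toMul) - 1 ∈ relPow (m + 2) S.inl.range := by
  obtain ⟨σ, hσ⟩ := exists_section_one S
  induction x using groupHomology.H2_induction_on with
  | h x =>
    have hr : rhoCycles ℤ m x = 0 := (rhoTriv_H2π ℤ m x).symm.trans hx
    have hr' := (Submodule.Quotient.mk_eq_zero (Bd2 (groupAug ℤ G) m)).1 hr
    have h1 := barLift_mem_relPow hC σ hσ m x.1 hr'
    have h2 := sub_mem h1 (kernelMulAug_le_relPow (m + 2) (barLift_sub_kappa_mem hC σ x))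
    rwa [sub_sub_cancel] at h2

/-- Every element of `𝔢^{m+2}` is congruent modulo `𝔠𝔢` to the lift of a bar chain that vanishes
in `P_m B_2`. -/
theorem exists_chain_of_mem_pow (hC : S.inl.range ≤ Subgroup.center E) (σ : S.Section) (m : ℕ)
    {u : MonoidAlgebra ℤ E} (hu : u ∈ augIdeal (groupAug ℤ E) ^ (m + 2)) :
    ∃ x : G × G →₀ ℤ, rhoChain2 ℤ m x = 0 ∧ barLift σ x - u ∈ kernelMulAug S ∧
      (groupHomology.d₂₁ (Rep.trivial ℤ G ℤ)).hom x = -(groupRingProj S u).coeff := by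
  -- The splitting 𝔢^{m+1}·𝔢 puts the high power in the first slot of the bar chain, which P_mB_2
  -- truncates at 𝔤^{m+1}.
  rw [Submodule.pow_succ] at hu
  refine Submodule.smul_induction_on hu ?_ ?_
  · intro p hp q hq
    have hpa : p ∈ aug (groupAug ℤ E) := Ideal.pow_le_self (Nat.succ_ne_zero m) hp
    have hp' := groupRingProj_mem_aug (S := S) hpa
    have hq' := groupRingProj_mem_aug (S := S) hq
    have hpow : groupRingProj S p ∈ augIdeal (groupAug ℤ G) ^ (m + 1) :=
      groupRingProj_mem_pow _ hp
    refine ⟨barPairing ℤ G (groupRingProj S p) (groupRingProj S q),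
      rhoChain2_barPairing_eq_zero ℤ m ⟨_, hp'⟩ ⟨_, hq'⟩ hpow, ?_, ?_⟩
    · rw [barLift_barPairing, groupAug_eq_zero_of_mem hp', groupAug_eq_zero_of_mem hq', zero_smul,
        sub_zero, sub_zero]
      exact lift_mul_lift_sub_mem hC (groupRingProj_groupRingSection _ _)
        (groupRingProj_groupRingSection _ _) hpa (groupRingSection_mem_aug _ hq')
    · rw [d₂₁_barPairing, groupAug_eq_zero_of_mem hp', groupAug_eq_zero_of_mem hq', zero_smul,
        zero_smul, zero_sub, add_zero, smul_eq_mul, map_mul]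
  · rintro u v ⟨x, hx, hxu, hxd⟩ ⟨y, hy, hyv, hyd⟩
    refine ⟨x + y, ?_, ?_, ?_⟩
    · rw [map_add, hx, hy]
      exact add_zero _
    · rw [map_add, add_sub_add_comm]
      exact add_mem hxu hyv
    · rw [map_add, hxd, hyd, map_add, coeff_add, neg_add]

theorem exists_kappa_eq (hC : S.inl.range ≤ Subgroup.center E) (m : ℕ) (c : C)
    (hc : of ℤ E (S.inl c) - 1 ∈ relPow (m + 2) S.inl.range) :
    ∃ x : H2Z G, rho m G x = 0 ∧ (kappa S hC x).toMul = c := by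
  set σ := someSection S
  obtain ⟨w, hw, u, hu, hwu⟩ := Submodule.mem_sup.1 hc
  obtain ⟨x, hx, hxu, hxd⟩ := exists_chain_of_mem_pow hC σ m hu
  -- Both c - 1 and w die in ℤ[G], hence so does u; this makes the chain x a cycle.
  have hpu : groupRingProj S u = 0 := by
    have h := congrArg (groupRingProj S) hwu
    rw [map_add, groupRingProj_eq_zero_of_mem hw, zero_add] at h
    rw [h, map_sub, map_one]
    simp [one_def]
  have hcyc : (groupHomology.d₂₁ (Rep.trivial ℤ G ℤ)).hom x = 0 := by
    rw [hxd, hpu]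
    simp
  let y : groupHomology.cycles₂ (Rep.trivial ℤ G ℤ) := ⟨x, hcyc⟩
  refine ⟨groupHomology.H2π (Rep.trivial ℤ G ℤ) y, ?_, ?_⟩
  · refine (rhoTriv_H2π ℤ m y).trans ((Submodule.Quotient.mk_eq_zero (Bd2 (groupAug ℤ G) m)).2 ?_)
    -- The image of x in P_mB_2 is zero as a chain, so it bounds 0.
    exact ⟨0, (map_zero _).trans hx.symm⟩
  · refine eq_of_sub_mem_kernelMulAug (S := S) ?_
    have h := sub_mem (sub_mem hxu (barLift_sub_kappa_mem hC σ y)) hw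
    rw [← hwu]
    convert h using 1
    change _ = barLift σ x - u - (barLift σ x - _) - w
    abel

end Comparison

end PolyBar

end

theorem mainTheorem3 {C G : Type} {E : Type*} [CommGroup C] [Group E] [Group G]
    (S : GroupExtension C E G) (hC : S.inl.range ≤ Subgroup.center E)
    (n : ℕ) (hn : 2 ≤ n) (hE : Subgroup.lowerCentralSeries (⊤ : Subgroup E) (n - 1) = ⊥) :
    ((PolyBar.relDimSubgroup n S.inl.range ⊓ S.inl.range : Subgroup E) : Set E) =
      (fun x : PolyBar.H2Z G => S.inl (PolyBar.kappa S hC x).toMul) ''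
        {x : PolyBar.H2Z G | PolyBar.rho (n - 2) G x = 0} := by
  obtain ⟨m, rfl⟩ := Nat.exists_eq_add_of_le' hn
  -- With n = m + 2, the truncated difference n - 2 is m by definition.
  generalize hk : m + 2 - 2 = k
  obtain rfl : m = k := hk
  ext e
  constructor
  · rintro ⟨he, c, rfl⟩
    obtain ⟨x, hx, hxc⟩ := PolyBar.exists_kappa_eq hC m c he
    exact ⟨x, hx, congrArg S.inl hxc⟩
  · rintro ⟨x, hx, rfl⟩
    exact ⟨PolyBar.kappa_mem_relPow hC m x hx, _, rfl⟩
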